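/- Let $\Omega=(0,4)^2\times(-2,2)\subset\mathbb R^3$ and $P(x)=\frac{x_1^2+x_2^2+x_3^2}{2}-\frac{x_1x_2}{2}$. Then $P\in C^\infty(\overline\Omega)$ is a convex solution of the Dirichlet problem $\det D^2u=\frac34$ in $\Omega$, $u=P$ on $\partial\Omega$. Let $\widehat f\in C^\infty(\overline\Omega)$ satisfy $\widehat f=\frac34$ on $\partial\Omega$ and $0<\widehat f\le\frac34$ in $\Omega$, with $\widehat f$ not identically $\frac34$ in $\Omega$. Then $\det D^2P=\widehat f$ on all of $\partial\Omega$, but the Dirichlet problem $\det D^2u=\widehat f$ in $\Omega$, $u=P$ on $\partial\Omega$ has no convex solution $u\in C^2(\overline\Omega)$. -/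

import Mathlib

open scoped ContDiff

/-- The Hessian matrix `D²u(x)`, with entries the second partial derivatives of `u` at `x`. It is
only ever evaluated at points near which `u` is twice differentiable. -/
noncomputable def hessianMatrix {n : ℕ} (u : EuclideanSpace ℝ (Fin n) → ℝ)
    (x : EuclideanSpace ℝ (Fin n)) : Matrix (Fin n) (Fin n) ℝ :=
  Matrix.of fun i j =>
    fderiv ℝ (fderiv ℝ u) x (EuclideanSpace.single i 1) (EuclideanSpace.single j 1)

/-- `u` is a convex solution in `C²(Ω̄)` of the Dirichlet problem `det D²u = f` in `Ω`,
`u = φ` on `∂Ω`. -/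
structure IsConvexC2Solution {n : ℕ} (Ω : Set (EuclideanSpace ℝ (Fin n)))
    (f φ u : EuclideanSpace ℝ (Fin n) → ℝ) : Prop where
  contDiffOn : ContDiffOn ℝ 2 u (closure Ω)
  convexOn : ConvexOn ℝ (closure Ω) u
  det_eq : ∀ x ∈ Ω, (hessianMatrix u x).det = f x
  boundary_eq : ∀ x ∈ frontier Ω, u x = φ x

/-- The open box `(0,4) × (0,4) × (-2,2)` in `ℝ³`. -/
def boxDomain : Set (EuclideanSpace ℝ (Fin 3)) :=
  {x | x 0 ∈ Set.Ioo (0 : ℝ) 4 ∧ x 1 ∈ Set.Ioo (0 : ℝ) 4 ∧ x 2 ∈ Set.Ioo (-2 : ℝ) 2}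

/-- The quadratic polynomial `P(x) = (x₁² + x₂² + x₃²)/2 - x₁x₂/2` on `ℝ³`. -/
noncomputable def quadP (x : EuclideanSpace ℝ (Fin 3)) : ℝ :=
  (x 0 ^ 2 + x 1 ^ 2 + x 2 ^ 2) / 2 - x 0 * x 1 / 2

open Matrix Filter Topology Set

/-! The obstruction sits at the edge x₁ = x₂ = 0, near the origin, which is its midpoint. Suppose
`u` is a solution and put w = u - P.

Growth: since det D²u ≤ 3/4, comparison gives w ≥ 0, and a strong minimum principle gives w > 0
inside the box. The linearisation of det at P is tr(cof(D²P) D²w). In linear coordinates turning it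
into a Laplacian, the right angle between the two faces becomes 120°, because cos = ∂₁₂P = -1/2.
Positive solutions in such a wedge grow like r^(3/2), more slowly than r², so a quadratic lower
barrier fits: w ≥ c t² on the diagonal t(1,1,0) (`exists_quadratic_separation`).

Contact: if `u` is C² up to the boundary, w = 0 on the faces kills every entry of D²w on the edge
except h = ∂₁₂w. The equation, with right-hand side 3/4 there, leaves h(h - 1) = 0. At the vertex
(0,0,2) the third face forces h = 0, and continuity along the edge carries this to the origin. So w
vanishes to second order along the diagonal (`exists_fderiv_diagonal_eq_zero`), contradicting the
growth. -/

/-! ### Determinant monotonicity and the second-order test at a minimum. -/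

/-- The determinant is monotone on positive definite matrices. -/
theorem Matrix.PosDef.det_le_det_add {ι : Type*} [Fintype ι] [DecidableEq ι]
    {S N : Matrix ι ι ℝ} (hS : S.PosDef) (hN : N.PosSemidef) : S.det ≤ (S + N).det := by
  -- Congruence by `B` reduces to S = 1, where the determinant is the product of 1 + λᵢ with λᵢ ≥ 0.
  obtain ⟨B, hB, rfl⟩ : ∃ B : Matrix ι ι ℝ, IsUnit B.det ∧ S = Bᴴ * B := by
    open scoped MatrixOrder in
    obtain ⟨B, rfl⟩ := CStarAlgebra.nonneg_iff_eq_star_mul_self.mp hS.posSemidef.nonneg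
    refine ⟨B, ?_, rfl⟩
    have := hS.det_pos
    rw [det_mul] at this
    exact isUnit_iff_ne_zero.mpr (right_ne_zero_of_mul this.ne')
  obtain ⟨N', hN', rfl⟩ : ∃ N' : Matrix ι ι ℝ, N'.PosSemidef ∧ N = Bᴴ * N' * B := by
    refine ⟨B⁻¹ᴴ * N * B⁻¹, hN.conjTranspose_mul_mul_same _, ?_⟩
    have h1 : B⁻¹ * B = 1 := nonsing_inv_mul _ hB
    have h2 : Bᴴ * B⁻¹ᴴ = 1 := by rw [← conjTranspose_mul, h1, conjTranspose_one]
    calc N = (Bᴴ * B⁻¹ᴴ) * N * (B⁻¹ * B) := by rw [h1, h2]; simp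
      _ = _ := by simp only [Matrix.mul_assoc]
  have key : 1 ≤ (1 + N').det := by
    have hU := hN'.1.spectral_theorem
    set U := hN'.1.eigenvectorUnitary
    have e : 1 + N' = Unitary.conjStarAlgAut ℝ _ U
        (diagonal fun i => 1 + hN'.1.eigenvalues i) := by
      have : (diagonal fun i => 1 + hN'.1.eigenvalues i)
          = 1 + diagonal (RCLike.ofReal ∘ hN'.1.eigenvalues : ι → ℝ) := by
        rw [← diagonal_one, diagonal_add]; rfl
      rw [this, map_add, map_one, ← hU]
    have hdet : (1 + N').det = ∏ i, (1 + hN'.1.eigenvalues i) := by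
      have hUU : (U : Matrix ι ι ℝ).det * (star (U : Matrix ι ι ℝ)).det = 1 := by
        rw [← det_mul, Unitary.mul_star_self_of_mem U.2, det_one]
      rw [e, Unitary.conjStarAlgAut_apply, det_mul, det_mul, det_diagonal]
      linear_combination (∏ i, (1 + hN'.1.eigenvalues i)) * hUU
    rw [hdet]
    calc (1 : ℝ) = ∏ _i : ι, 1 := by simp
      _ ≤ _ := Finset.prod_le_prod (fun _ _ => zero_le_one)
        fun i _ => by linarith [hN'.eigenvalues_nonneg i]
  have e : Bᴴ * B + Bᴴ * N' * B = Bᴴ * (1 + N') * B := by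
    rw [Matrix.mul_add, Matrix.add_mul, Matrix.mul_one]
  rw [e, det_mul, det_mul, det_mul, det_conjTranspose, star_trivial]
  nlinarith [mul_self_nonneg B.det]

theorem ContDiffAt.hasFDerivAt_fderiv {E F : Type*} [NormedAddCommGroup E] [NormedSpace ℝ E]
    [NormedAddCommGroup F] [NormedSpace ℝ F] {g : E → F} {x : E} (hg : ContDiffAt ℝ 2 g x) :
    HasFDerivAt (fderiv ℝ g) (fderiv ℝ (fderiv ℝ g) x) x :=
  ((hg.fderiv_right (m := 1) (by norm_num)).differentiableAt (by norm_num)).hasFDerivAt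

/-- Second-order necessary condition at an interior minimum. -/
theorem IsLocalMin.fderiv_fderiv_nonneg {E : Type*} [NormedAddCommGroup E] [NormedSpace ℝ E]
    {g : E → ℝ} {x : E} (hmin : IsLocalMin g x) (hg : ContDiffAt ℝ 2 g x) (ξ : E) :
    0 ≤ fderiv ℝ (fderiv ℝ g) x ξ ξ := by
  by_contra! hneg
  set γ : ℝ → E := fun t => x + t • ξ
  have hγ : ∀ t, HasDerivAt γ ξ t := fun t => by
    have := ((hasDerivAt_id t).smul_const ξ).const_add x
    rwa [one_smul] at this
  have hγ0 : γ 0 = x := by simp [γ]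
  have hγc : Tendsto γ (𝓝 0) (𝓝 x) := by
    simpa [hγ0] using (hγ 0).continuousAt.tendsto
  have hev : ∀ᶠ y in 𝓝 x, ContDiffAt ℝ 2 g y := hg.eventually (by simp)
  have hd1 : ∀ᶠ t in 𝓝 (0 : ℝ), HasDerivAt (g ∘ γ) (fderiv ℝ g (γ t) ξ) t := by
    filter_upwards [hγc.eventually hev] with t ht
    exact (ht.differentiableAt (by norm_num)).hasFDerivAt.comp_hasDerivAt t (hγ t)
  have hd1' : deriv (g ∘ γ) =ᶠ[𝓝 0] fun t => fderiv ℝ g (γ t) ξ := by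
    filter_upwards [hd1] with t ht using ht.deriv
  have hd2 : deriv (deriv (g ∘ γ)) 0 = fderiv ℝ (fderiv ℝ g) x ξ ξ := by
    rw [hd1'.deriv_eq]
    have h1 : HasFDerivAt (fderiv ℝ g) (fderiv ℝ (fderiv ℝ g) x) (γ 0) := by
      rw [hγ0]; exact hg.hasFDerivAt_fderiv
    have h2 := (h1.comp_hasDerivAt 0 (hγ 0)).clm_apply (hasDerivAt_const (0 : ℝ) ξ)
    simpa using h2.deriv
  have hm : IsLocalMin (g ∘ γ) 0 := by
    have := hγc.eventually hmin
    simpa [IsLocalMin, IsMinFilter, hγ0] using this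
  -- A negative second derivative makes the minimum also a maximum, so `g ∘ γ` is locally constant
  -- and that derivative is zero.
  have hM : IsLocalMax (g ∘ γ) 0 :=
    isLocalMax_of_deriv_deriv_neg (by rw [hd2]; exact hneg) hm.deriv_eq_zero
      hd1.self_of_nhds.continuousAt
  have hc : (g ∘ γ) =ᶠ[𝓝 0] fun _ => (g ∘ γ) 0 := by
    filter_upwards [hm, hM] with t h1 h2 using le_antisymm h2 h1
  have hc1 : deriv (g ∘ γ) =ᶠ[𝓝 0] fun _ => 0 := by
    filter_upwards [hc.deriv] with t ht
    rw [ht]; simp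
  rw [hc1.deriv_eq] at hd2
  simp at hd2
  linarith

/-! ### Hessians, touching and comparison. -/

section Hessian

variable {n : ℕ}

theorem hessianMatrix_isHermitian {u : EuclideanSpace ℝ (Fin n) → ℝ}
    {x : EuclideanSpace ℝ (Fin n)} (hu : ContDiffAt ℝ 2 u x) :
    (hessianMatrix u x).IsHermitian := by
  ext i j
  have := (hu.isSymmSndFDerivAt (by simp)).eq (EuclideanSpace.single i 1)
    (EuclideanSpace.single j 1)
  simp [hessianMatrix, this]

theorem dotProduct_hessianMatrix_mulVec (u : EuclideanSpace ℝ (Fin n) → ℝ)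
    (x : EuclideanSpace ℝ (Fin n)) (ξ : Fin n → ℝ) :
    ξ ⬝ᵥ hessianMatrix u x *ᵥ ξ
      = fderiv ℝ (fderiv ℝ u) x (WithLp.toLp 2 ξ) (WithLp.toLp 2 ξ) := by
  have h : WithLp.toLp 2 ξ = ∑ i, ξ i • (EuclideanSpace.single i 1 : EuclideanSpace ℝ (Fin n)) := by
    ext j; simp [Pi.single_apply]
  conv_rhs => rw [h]
  simp only [map_sum, map_smul, _root_.sum_apply, _root_.smul_apply,
    dotProduct, mulVec, hessianMatrix, Matrix.of_apply, smul_eq_mul, Finset.mul_sum]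
  rw [Finset.sum_comm]
  refine Finset.sum_congr rfl fun i _ => Finset.sum_congr rfl fun j _ => ?_
  ring

theorem hessianMatrix_sub {u v : EuclideanSpace ℝ (Fin n) → ℝ} {x : EuclideanSpace ℝ (Fin n)}
    (hu : ContDiffAt ℝ 2 u x)
    (hv : ContDiffAt ℝ 2 v x) :
    hessianMatrix (u - v) x = hessianMatrix u x - hessianMatrix v x := by
  have h : fderiv ℝ (u - v) =ᶠ[𝓝 x] fderiv ℝ u - fderiv ℝ v := by
    filter_upwards [hu.eventually (by simp), hv.eventually (by simp)] with y h1 h2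
    exact fderiv_sub (h1.differentiableAt (by norm_num)) (h2.differentiableAt (by norm_num))
  ext i j
  simp only [hessianMatrix, Matrix.of_apply, Matrix.sub_apply]
  rw [h.fderiv_eq, fderiv_sub hu.hasFDerivAt_fderiv.differentiableAt
    hv.hasFDerivAt_fderiv.differentiableAt]
  rfl

/-- Touching principle: where `u - v` has a local minimum and `v` is strictly convex,
`det D²v ≤ det D²u`. -/
theorem IsLocalMin.det_hessianMatrix_le {u v : EuclideanSpace ℝ (Fin n) → ℝ}
    {x : EuclideanSpace ℝ (Fin n)}
    (hmin : IsLocalMin (u - v) x) (hu : ContDiffAt ℝ 2 u x) (hv : ContDiffAt ℝ 2 v x)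
    (hpos : (hessianMatrix v x).PosDef) :
    (hessianMatrix v x).det ≤ (hessianMatrix u x).det := by
  have hN : (hessianMatrix (u - v) x).PosSemidef := by
    refine .of_dotProduct_mulVec_nonneg (hessianMatrix_isHermitian (hu.sub hv)) fun ξ => ?_
    rw [star_trivial, dotProduct_hessianMatrix_mulVec]
    exact hmin.fderiv_fderiv_nonneg (hu.sub hv) _
  have := hpos.det_le_det_add hN
  rwa [hessianMatrix_sub hu hv, add_sub_cancel] at this

/-- Comparison principle on a compact set `K`: the subsolution `v` lies below `u` as soon as it does
on the part of `K` that is not interior to the region where the strict inequality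
`det D²u < det D²v` is available. -/
theorem le_of_det_hessianMatrix_lt {u v : EuclideanSpace ℝ (Fin n) → ℝ}
    {K O : Set (EuclideanSpace ℝ (Fin n))} (hK : IsCompact K)
    (hO : IsOpen O) (hOK : O ⊆ K) (huc : ContinuousOn u K) (hvc : ContinuousOn v K)
    (hu : ∀ x ∈ O, ContDiffAt ℝ 2 u x) (hv : ∀ x ∈ O, ContDiffAt ℝ 2 v x)
    (hpos : ∀ x ∈ O, (hessianMatrix v x).PosDef)
    (hdet : ∀ x ∈ O, (hessianMatrix u x).det < (hessianMatrix v x).det)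
    (hbd : ∀ x ∈ K \ O, v x ≤ u x) : ∀ x ∈ K, v x ≤ u x := by
  intro x hx
  obtain ⟨z, hz, hmin⟩ := hK.exists_isMinOn ⟨x, hx⟩ (huc.sub hvc)
  have hxz : u z - v z ≤ u x - v x := hmin hx
  by_cases hzO : z ∈ O
  · have : IsLocalMin (u - v) z := (hmin.on_subset hOK).isLocalMin (hO.mem_nhds hzO)
    exact absurd (this.det_hessianMatrix_le (hu z hzO) (hv z hzO) (hpos z hzO))
      (not_le.mpr (hdet z hzO))
  · linarith [hbd z ⟨hz, hzO⟩]

/-- The quadratic polynomial with Hessian `S`, gradient `g` at the origin, and value `c` there. -/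
noncomputable def quadPoly (S : Matrix (Fin n) (Fin n) ℝ) (g : Fin n → ℝ) (c : ℝ)
    (x : EuclideanSpace ℝ (Fin n)) : ℝ :=
  (∑ i, ∑ j, S i j * (x i * x j)) / 2 + ∑ i, g i * x i + c

theorem contDiff_quadPoly (S : Matrix (Fin n) (Fin n) ℝ) (g : Fin n → ℝ) (c : ℝ) {k : ℕ∞ω} :
    ContDiff ℝ k (quadPoly S g c) := by
  unfold quadPoly
  fun_prop

theorem hessianMatrix_quadPoly {S : Matrix (Fin n) (Fin n) ℝ} (hS : S.IsSymm) (g : Fin n → ℝ)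
    (c : ℝ) (x : EuclideanSpace ℝ (Fin n)) : hessianMatrix (quadPoly S g c) x = S := by
  let p : Fin n → (EuclideanSpace ℝ (Fin n)) →L[ℝ] ℝ := fun i => EuclideanSpace.proj i
  have hp : ∀ i (y : EuclideanSpace ℝ (Fin n)),
      HasFDerivAt (fun y : EuclideanSpace ℝ (Fin n) => y i) (p i) y := fun i y =>
    (p i).hasFDerivAt
  have h1 : ∀ y, HasFDerivAt (quadPoly S g c)
      (∑ i, ∑ j, (S i j * y j) • p i + ∑ i, g i • p i) y := by
    intro y
    have := (((HasFDerivAt.fun_sum (u := Finset.univ) fun i _ => HasFDerivAt.fun_sum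
      (u := Finset.univ) fun j _ => ((hp i y).mul (hp j y)).const_mul (S i j)).mul_const
      (2⁻¹ : ℝ)).add (HasFDerivAt.fun_sum (u := Finset.univ) fun i _ =>
        (hp i y).const_mul (g i))).add_const c
    refine (this.congr_fderiv ?_)
    congr 1
    ext ξ
    simp only [_root_.smul_apply, _root_.sum_apply,
      _root_.add_apply, smul_eq_mul, mul_add, Finset.sum_add_distrib]
    have : ∑ i, ∑ j, S i j * (y i * p j ξ) = ∑ i, ∑ j, S i j * (y j * p i ξ) := by
      rw [Finset.sum_comm]
      refine Finset.sum_congr rfl fun i _ => Finset.sum_congr rfl fun j _ => ?_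
      rw [hS.apply i j]
    rw [this, ← mul_add, ← two_mul, ← mul_assoc]
    norm_num
    simp only [mul_assoc]
  have h2 : fderiv ℝ (quadPoly S g c) =
      fun y => ∑ i, ∑ j, (S i j * y j) • p i + ∑ i, g i • p i := funext fun y => (h1 y).fderiv
  have h3 :
      HasFDerivAt (fun y : EuclideanSpace ℝ (Fin n) => ∑ i, ∑ j, (S i j * y j) • p i + ∑ i, g i • p i)
      (∑ i, ∑ j, (S i j • p j).smulRight (p i)) x :=
    (HasFDerivAt.fun_sum fun i _ => HasFDerivAt.fun_sum fun j _ =>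
      ((hp j x).const_mul (S i j)).smul_const (p i)).add_const _
  ext i j
  rw [hessianMatrix, Matrix.of_apply, h2, h3.fderiv]
  simp only [_root_.sum_apply, ContinuousLinearMap.smulRight_apply, _root_.smul_apply, p]
  simp [hS.apply i j]

end Hessian

/-! ### Perturbations of P as barriers; weak and strong comparison with P. -/

section ModelQuadratic

/-- The Hessian of `quadP`. -/
noncomputable def hessP : Matrix (Fin 3) (Fin 3) ℝ := !![1, -1/2, 0; -1/2, 1, 0; 0, 0, 1]

theorem quadP_eq_quadPoly : quadP = quadPoly hessP 0 0 := by
  ext x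
  simp [quadP, quadPoly, hessP, Fin.sum_univ_three]
  ring

theorem contDiff_quadP {k : ℕ∞ω} : ContDiff ℝ k quadP :=
  quadP_eq_quadPoly ▸ contDiff_quadPoly _ _ _

theorem hessP_isSymm : hessP.IsSymm := by
  ext i j
  fin_cases i <;> fin_cases j <;> simp [hessP]

theorem hessianMatrix_quadP (x : EuclideanSpace ℝ (Fin 3)) : hessianMatrix quadP x = hessP :=
  quadP_eq_quadPoly ▸ hessianMatrix_quadPoly hessP_isSymm 0 0 x

theorem det_hessP : hessP.det = 3 / 4 := by
  simp [hessP, det_fin_three]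
  norm_num

theorem inner_fin_three (x y : EuclideanSpace ℝ (Fin 3)) :
    inner ℝ x y = x 0 * y 0 + x 1 * y 1 + x 2 * y 2 := by
  simp [PiLp.inner_apply, Fin.sum_univ_three, mul_comm]

theorem norm_sq_fin_three (x : EuclideanSpace ℝ (Fin 3)) : ‖x‖ ^ 2 = x 0 ^ 2 + x 1 ^ 2 + x 2 ^ 2 :=
    by
  rw [EuclideanSpace.real_norm_sq_eq, Fin.sum_univ_three]

/-- The Hessian of `quadP + ε * (⟪ν, · - p⟫² + σ * ‖· - p‖² + c)`. -/
noncomputable def perturbedHess (ν : EuclideanSpace ℝ (Fin 3)) (σ ε : ℝ) : Matrix (Fin 3)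
    (Fin 3) ℝ :=
  hessP + (2 * ε) • (vecMulVec ν ν + σ • 1)

theorem perturbedHess_isSymm (ν : EuclideanSpace ℝ (Fin 3)) (σ ε : ℝ) :
    (perturbedHess ν σ ε).IsSymm := by
  refine hessP_isSymm.add (IsSymm.smul (IsSymm.add ?_ (IsSymm.smul isSymm_one _)) _)
  ext i j
  simp [vecMulVec_apply, mul_comm]

/-- The function `quadP + ε * (⟪ν, · - p⟫² + σ * ‖· - p‖² + c)`. -/
noncomputable def perturbedP (ν p : EuclideanSpace ℝ (Fin 3)) (σ c ε : ℝ)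
    (x : EuclideanSpace ℝ (Fin 3)) : ℝ :=
  quadP x + ε * (inner ℝ ν (x - p) ^ 2 + σ * ‖x - p‖ ^ 2 + c)

theorem perturbedP_eq_quadPoly (ν p : EuclideanSpace ℝ (Fin 3)) (σ c ε : ℝ) :
    perturbedP ν p σ c ε = quadPoly (perturbedHess ν σ ε)
      (fun i => -2 * ε * (inner ℝ ν p * ν i + σ * p i))
      (ε * (inner ℝ ν p ^ 2 + σ * ‖p‖ ^ 2 + c)) := by
  ext x
  simp only [perturbedP, quadPoly, perturbedHess, quadP, inner_fin_three, norm_sq_fin_three,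
    Fin.sum_univ_three, hessP]
  simp [vecMulVec_apply]
  ring

theorem contDiff_perturbedP (ν p : EuclideanSpace ℝ (Fin 3)) (σ c ε : ℝ) {k : ℕ∞ω} :
    ContDiff ℝ k (perturbedP ν p σ c ε) :=
  perturbedP_eq_quadPoly ν p σ c ε ▸ contDiff_quadPoly _ _ _

theorem hessianMatrix_perturbedP (ν p : EuclideanSpace ℝ (Fin 3)) (σ c ε : ℝ)
    (x : EuclideanSpace ℝ (Fin 3)) :
    hessianMatrix (perturbedP ν p σ c ε) x = perturbedHess ν σ ε :=
  perturbedP_eq_quadPoly ν p σ c ε ▸ hessianMatrix_quadPoly (perturbedHess_isSymm ν σ ε) _ _ x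

/-- The least eigenvalue of `hessP` is 1/2, and the rank-one term only helps. -/
theorem perturbedHess_posDef (ν : EuclideanSpace ℝ (Fin 3)) {σ ε : ℝ} (hε : 0 ≤ ε)
    (hσ : 0 < 1 / 2 + 2 * ε * σ) :
    (perturbedHess ν σ ε).PosDef := by
  refine .of_dotProduct_mulVec_pos ?_ fun ξ hξ => ?_
  · rw [IsHermitian, conjTranspose_eq_transpose_of_trivial]
    exact perturbedHess_isSymm ν σ ε
  · have hpos : 0 < ξ 0 ^ 2 + ξ 1 ^ 2 + ξ 2 ^ 2 := by
      by_contra! h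
      apply hξ
      ext i
      fin_cases i <;> simp <;> nlinarith [sq_nonneg (ξ 0), sq_nonneg (ξ 1), sq_nonneg (ξ 2)]
    have e : star ξ ⬝ᵥ perturbedHess ν σ ε *ᵥ ξ = (ξ 0 - ξ 1) ^ 2 / 2 + ξ 2 ^ 2 / 2
        + 2 * ε * (ν 0 * ξ 0 + ν 1 * ξ 1 + ν 2 * ξ 2) ^ 2
        + (1 / 2 + 2 * ε * σ) * (ξ 0 ^ 2 + ξ 1 ^ 2 + ξ 2 ^ 2) := by
      simp [perturbedHess, hessP, dotProduct, mulVec, Fin.sum_univ_three, vecMulVec_apply]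
      ring
    rw [e]
    have := mul_pos hσ hpos
    positivity

/-- If the quadratic form is a strict subsolution of the linearised equation at `quadP`, small
perturbations are strictly convex strict subsolutions of `det D²v = 3/4`. -/
theorem eventually_perturbedHess {ν : EuclideanSpace ℝ (Fin 3)} {σ : ℝ}
    (h : 0 < ν 0 ^ 2 + ν 1 ^ 2 + ν 0 * ν 1 + 3 / 4 * ν 2 ^ 2 + 11 / 4 * σ) :
    ∀ᶠ ε in 𝓝[>] (0 : ℝ), (perturbedHess ν σ ε).PosDef ∧ 3 / 4 < (perturbedHess ν σ ε).det := by
  have h1 : ∀ᶠ ε in 𝓝 (0 : ℝ), 0 < 1 / 2 + 2 * ε * σ := by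
    have : Continuous fun ε : ℝ => 1 / 2 + 2 * ε * σ := by fun_prop
    exact this.continuousAt.eventually (lt_mem_nhds (by norm_num))
  -- The first-order coefficient is 2 tr(cof(`hessP`)(ννᵀ + σ)); the cofactor matrix has trace 11/4.
  obtain ⟨c₂, c₃, hdet⟩ : ∃ c₂ c₃ : ℝ, ∀ ε, (perturbedHess ν σ ε).det = 3 / 4 + ε *
      (2 * (ν 0 ^ 2 + ν 1 ^ 2 + ν 0 * ν 1 + 3 / 4 * ν 2 ^ 2 + 11 / 4 * σ)
        + ε * c₂ + ε ^ 2 * c₃) := by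
    refine ⟨4 * σ * (2 * (ν 0 ^ 2 + ν 1 ^ 2 + ν 2 ^ 2) + ν 0 * ν 1 + 3 * σ),
      8 * (σ ^ 3 + σ ^ 2 * (ν 0 ^ 2 + ν 1 ^ 2 + ν 2 ^ 2)), fun ε => ?_⟩
    simp [perturbedHess, hessP, det_fin_three, vecMulVec_apply]
    ring
  have h2 : ∀ᶠ ε in 𝓝 (0 : ℝ),
      0 < 2 * (ν 0 ^ 2 + ν 1 ^ 2 + ν 0 * ν 1 + 3 / 4 * ν 2 ^ 2 + 11 / 4 * σ)
        + ε * c₂ + ε ^ 2 * c₃ := by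
    have : Continuous fun ε : ℝ =>
      2 * (ν 0 ^ 2 + ν 1 ^ 2 + ν 0 * ν 1 + 3 / 4 * ν 2 ^ 2 + 11 / 4 * σ)
        + ε * c₂ + ε ^ 2 * c₃ := by fun_prop
    exact this.continuousAt.eventually (lt_mem_nhds (by linarith))
  filter_upwards [nhdsWithin_le_nhds h1, nhdsWithin_le_nhds h2, self_mem_nhdsWithin]
    with ε e1 e2 (e3 : 0 < ε)
  refine ⟨perturbedHess_posDef ν e3.le e1, ?_⟩
  rw [hdet]
  linarith [mul_pos e3 e2]

variable {Ω : Set (EuclideanSpace ℝ (Fin 3))} {u : EuclideanSpace ℝ (Fin 3) → ℝ}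

/-- Comparison with `quadP` on a bounded domain. -/
theorem quadP_le_of_det_le (hΩ : IsOpen Ω) (hb : Bornology.IsBounded Ω)
    (hu : ∀ x ∈ Ω, ContDiffAt ℝ 2 u x) (huc : ContinuousOn u (closure Ω))
    (hdet : ∀ x ∈ Ω, (hessianMatrix u x).det ≤ 3 / 4)
    (hbd : ∀ x ∈ frontier Ω, quadP x ≤ u x) : ∀ x ∈ closure Ω, quadP x ≤ u x := by
  obtain ⟨R, hR⟩ := hb.closure.exists_norm_le
  -- The subsolution P + ε(|x|² - R²) lies below P on the closure; then ε → 0.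
  have hev : ∀ᶠ ε in 𝓝[>] (0 : ℝ), ∀ x ∈ closure Ω, perturbedP 0 0 1 (-R ^ 2) ε x ≤ u x := by
    filter_upwards [eventually_perturbedHess (ν := 0) (σ := 1) (by simp), self_mem_nhdsWithin]
      with ε hε (h0 : 0 < ε)
    refine le_of_det_hessianMatrix_lt hb.isCompact_closure hΩ subset_closure huc
      (contDiff_perturbedP (k := 0) _ _ _ _ _).continuous.continuousOn hu
      (fun x _ => (contDiff_perturbedP _ _ _ _ _).contDiffAt) (fun x _ => ?_) (fun x hx => ?_)
      fun x hx => ?_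
    · rw [hessianMatrix_perturbedP]; exact hε.1
    · rw [hessianMatrix_perturbedP]; exact (hdet x hx).trans_lt hε.2
    · have h1 := hbd x (hΩ.frontier_eq ▸ hx)
      have h2 : ‖x‖ ^ 2 ≤ R ^ 2 := pow_le_pow_left₀ (norm_nonneg _) (hR x hx.1) 2
      have h3 : ε * (‖x‖ ^ 2 + -R ^ 2) ≤ 0 :=
        mul_nonpos_of_nonneg_of_nonpos h0.le (by linarith)
      simp only [perturbedP, sub_zero, inner_zero_left]
      linarith
  intro x hx
  have hlim : Tendsto (fun ε => perturbedP 0 0 1 (-R ^ 2) ε x) (𝓝[>] 0) (𝓝 (quadP x)) := by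
    have : Continuous fun ε => perturbedP 0 0 1 (-R ^ 2) ε x := by unfold perturbedP; fun_prop
    simpa [perturbedP] using (this.tendsto 0).mono_left nhdsWithin_le_nhds
  exact le_of_tendsto hlim (hev.mono fun ε h => h x hx)

/-- Barrier in a solid cone with apex `p`: if `quadP ≤ u` in the cone with strict inequality on its
base, then `u - quadP` is bounded below by a multiple of the quadratic form defining the cone. -/
theorem exists_cone_barrier (hu : ∀ x ∈ Ω, ContDiffAt ℝ 2 u x) (huc : ContinuousOn u (closure Ω))
    (hdet : ∀ x ∈ Ω, (hessianMatrix u x).det ≤ 3 / 4)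
    (hle : ∀ x ∈ closure Ω, quadP x ≤ u x) {ν p : EuclideanSpace ℝ (Fin 3)} {s : ℝ}
    (hν : 11 / 4 < ν 0 ^ 2 + ν 1 ^ 2 + ν 0 * ν 1 + 3 / 4 * ν 2 ^ 2) (hp : p ∈ closure Ω)
    (hK : ∀ x, x ≠ p → inner ℝ ν (x - p) ≤ s → ‖x - p‖ ≤ inner ℝ ν (x - p) → x ∈ Ω)
    (hbase : ∀ x, inner ℝ ν (x - p) = s → ‖x - p‖ ≤ s → x ∈ closure Ω → quadP x < u x) :
    ∃ ε > 0, ∀ x, inner ℝ ν (x - p) ≤ s → ‖x - p‖ ≤ inner ℝ ν (x - p) →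
      quadP x + ε * (inner ℝ ν (x - p) ^ 2 - ‖x - p‖ ^ 2) ≤ u x := by
  set l : EuclideanSpace ℝ (Fin 3) → ℝ := fun x => inner ℝ ν (x - p)
  have hl : Continuous l := by fun_prop
  have hd : Continuous fun x : EuclideanSpace ℝ (Fin 3) => ‖x - p‖ := by fun_prop
  set K : Set (EuclideanSpace ℝ (Fin 3)) := {x | l x ≤ s ∧ ‖x - p‖ ≤ l x}
  have hKc : IsCompact K := by
    refine Metric.isCompact_of_isClosed_isBounded
      ((isClosed_le hl continuous_const).inter (isClosed_le hd hl)) ?_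
    refine Metric.isBounded_closedBall (x := p) (r := s) |>.subset fun x hx => ?_
    rw [mem_closedBall_iff_norm]
    exact hx.2.trans hx.1
  have hKΩ : K ⊆ closure Ω := fun x hx => by
    by_cases h : x = p
    · exact h ▸ hp
    · exact subset_closure (hK x h hx.1 hx.2)
  set O : Set (EuclideanSpace ℝ (Fin 3)) := {x | l x < s ∧ ‖x - p‖ < l x}
  have hO : IsOpen O := (isOpen_lt hl continuous_const).inter (isOpen_lt hd hl)
  have hOK : O ⊆ K := fun x hx => ⟨hx.1.le, hx.2.le⟩
  have hOΩ : O ⊆ Ω := fun x hx => by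
    refine hK x ?_ hx.1.le hx.2.le
    rintro rfl
    simpa [l] using hx.2
  have hPc : Continuous quadP := (contDiff_quadP (k := 0)).continuous
  -- On the compact base the gap is uniformly positive, so a small ε keeps the barrier below `u`; on
  -- the lateral surface the barrier equals P.
  obtain ⟨m, hm, hmb⟩ : ∃ m > 0, ∀ x ∈ K ∩ {x | l x = s}, m ≤ u x - quadP x := by
    refine (hKc.inter_right (isClosed_eq hl continuous_const)).exists_forall_le'
      (((huc.mono hKΩ).sub hPc.continuousOn).mono inter_subset_left) fun x hx => ?_
    have := hbase x hx.2 (hx.1.2.trans hx.1.1) (hKΩ hx.1)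
    simpa using this
  have hsm : ∀ᶠ ε in 𝓝[>] (0 : ℝ), ε * s ^ 2 ≤ m := by
    have : Continuous fun ε : ℝ => ε * s ^ 2 := by fun_prop
    have h : ∀ᶠ ε in 𝓝 (0 : ℝ), ε * s ^ 2 < m :=
      this.continuousAt.eventually (gt_mem_nhds (by simpa using hm))
    exact nhdsWithin_le_nhds (h.mono fun _ => le_of_lt)
  obtain ⟨ε, ⟨hpd, hε⟩, hεs, h0 : 0 < ε⟩ :=
    ((eventually_perturbedHess (ν := ν) (σ := -1) (by linarith)).and
      (hsm.and self_mem_nhdsWithin)).exists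
  refine ⟨ε, h0, fun x hxs hxp => ?_⟩
  have key := le_of_det_hessianMatrix_lt hKc hO hOK (huc.mono hKΩ)
    (contDiff_perturbedP (k := 0) ν p (-1) 0 ε).continuous.continuousOn (fun x hx => hu x (hOΩ hx))
    (fun x _ => (contDiff_perturbedP _ _ _ _ _).contDiffAt)
    (fun x _ => by rw [hessianMatrix_perturbedP]; exact hpd)
    (fun x hx => by rw [hessianMatrix_perturbedP]; exact (hdet x (hOΩ hx)).trans_lt hε)
    (fun x hx => ?_) x ⟨hxs, hxp⟩
  · simpa [perturbedP, l, ← sub_eq_add_neg] using key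
  · obtain ⟨hxK, hxO⟩ := hx
    have hP := hle x (hKΩ hxK)
    have hn := norm_nonneg (x - p)
    simp only [perturbedP]
    change quadP x + ε * (l x ^ 2 + -1 * ‖x - p‖ ^ 2 + 0) ≤ u x
    rcases hxK.1.lt_or_eq with h | h
    · have : ‖x - p‖ = l x := le_antisymm hxK.2 (not_lt.mp fun h' => hxO ⟨h, h'⟩)
      rw [this]
      linarith
    · have := hmb x ⟨hxK, h⟩
      rw [h]
      nlinarith [mul_nonneg h0.le (sq_nonneg ‖x - p‖)]

/-- Strong minimum principle for `u - quadP`. -/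
theorem quadP_lt_of_det_le (hΩ : IsOpen Ω) (hΩc : IsPreconnected Ω)
    (hu : ∀ x ∈ Ω, ContDiffAt ℝ 2 u x) (huc : ContinuousOn u (closure Ω))
    (hdet : ∀ x ∈ Ω, (hessianMatrix u x).det ≤ 3 / 4)
    (hle : ∀ x ∈ closure Ω, quadP x ≤ u x) (hne : ∃ x ∈ Ω, quadP x < u x) :
    ∀ x ∈ Ω, quadP x < u x := by
  have hPc : Continuous quadP := (contDiff_quadP (k := 0)).continuous
  have hcΩ : ∀ x ∈ Ω, ContinuousAt u x := fun x hx => (hu x hx).continuousAt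
  set U : Set (EuclideanSpace ℝ (Fin 3)) := {x | x ∈ Ω ∧ quadP x < u x}
  have hU : IsOpen U := by
    rw [isOpen_iff_mem_nhds]
    rintro x ⟨hx, hlt⟩
    filter_upwards [hΩ.mem_nhds hx, hPc.continuousAt.eventually_lt (hcΩ x hx) hlt] with y h1 h2
      using ⟨h1, h2⟩
  -- By connectedness it suffices that `U` is relatively closed in `Ω`.
  suffices h : closure U ∩ Ω ⊆ U by
    have := hΩc.subset_of_closure_inter_subset hU
      (by obtain ⟨x, hx, hlt⟩ := hne; exact ⟨x, hx, hx, hlt⟩) h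
    exact fun x hx => (this hx).2
  rintro x ⟨hxU, hxΩ⟩
  by_contra hxU'
  obtain ⟨ρ, hρ, hball⟩ : ∃ ρ > 0, Metric.ball x (4 * ρ) ⊆ Ω := by
    obtain ⟨δ, hδ, h⟩ := Metric.isOpen_iff.mp hΩ x hxΩ
    exact ⟨δ / 4, by positivity, by rwa [mul_div_cancel₀ _ (by norm_num : (4 : ℝ) ≠ 0)]⟩
  obtain ⟨y, hyU, hxy⟩ := Metric.mem_closure_iff.mp hxU ρ hρ
  have hZ : IsCompact (Metric.closedBall x (2 * ρ) \ U) := (isCompact_closedBall x _).diff hU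
  have hxZ : x ∈ Metric.closedBall x (2 * ρ) \ U :=
    ⟨Metric.mem_closedBall_self (by positivity), hxU'⟩
  -- Interior ball, as in Hopf's lemma: `z` is a contact point nearest to `y`, so the open ball
  -- about `y` through `z` lies in `U`.
  obtain ⟨z, ⟨hzx, hzU⟩, hzd⟩ := hZ.exists_infDist_eq_dist ⟨x, hxZ⟩ y
  set r := dist y z with hr
  have hrx : r ≤ dist y x := hzd ▸ Metric.infDist_le_dist_of_mem hxZ
  rw [dist_comm] at hxy
  have hr0 : 0 < r := dist_pos.mpr fun h => hzU (h ▸ hyU)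
  have hzr : Metric.ball z r ⊆ Ω := fun t ht => hball (by
    rw [Metric.mem_ball] at ht ⊢
    rw [Metric.mem_closedBall] at hzx
    linarith [dist_triangle t z x])
  have hyr : Metric.ball y r ⊆ U := fun t ht => by
    by_contra htU
    rw [Metric.mem_ball] at ht
    have : t ∈ Metric.closedBall x (2 * ρ) \ U := by
      refine ⟨?_, htU⟩
      rw [Metric.mem_closedBall]
      linarith [dist_triangle t y x]
    have h2 := Metric.infDist_le_dist_of_mem (x := y) this
    rw [hzd, dist_comm y t] at h2
    linarith
  have hzΩ : z ∈ Ω := hzr (Metric.mem_ball_self hr0)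
  obtain ⟨e, he⟩ : ∃ e : EuclideanSpace ℝ (Fin 3), e = y - z := ⟨_, rfl⟩
  have her : ‖e‖ = r := by rw [he, hr, dist_eq_norm]
  -- The least eigenvalue of cof(`hessP`) is 1/2, so |ν|² = 6 gives at least 3 > 11/4 in every
  -- direction.
  obtain ⟨c, hc0, hc⟩ : ∃ c : ℝ, 0 < c ∧ c ^ 2 = 6 := ⟨√6, by positivity, by norm_num⟩
  -- The apex is slightly behind `z`, so that `z` is interior to the cone while its base still lies
  -- in the ball about `y`. The barrier then forces P < u at `z`.
  set p : EuclideanSpace ℝ (Fin 3) := z - (1 / 20 : ℝ) • e with hpdef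
  have hin : ∀ t : EuclideanSpace ℝ (Fin 3),
      inner ℝ ((c / r) • e) (t - p) = c / r * inner ℝ e (t - p) := fun t =>
    real_inner_smul_left _ _ _
  have hxp : ∀ t, ‖t - p‖ ≤ c * r / 6 → t ∈ Metric.ball z r := fun t ht => by
    have h1 : ‖z - p‖ = r / 20 := by
      rw [hpdef, sub_sub_cancel, norm_smul, her]
      norm_num
      ring
    have h2 : c < 5 / 2 := by nlinarith
    rw [mem_ball_iff_norm]
    have h3 : ‖t - z‖ ≤ ‖t - p‖ + ‖z - p‖ := by
      have := norm_sub_le (t - p) (z - p)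
      rwa [sub_sub_sub_cancel_right] at this
    nlinarith
  have hν : 11 / 4 < ((c / r) • e) 0 ^ 2 + ((c / r) • e) 1 ^ 2 + ((c / r) • e) 0 * ((c / r) • e) 1
      + 3 / 4 * ((c / r) • e) 2 ^ 2 := by
    have h1 := norm_sq_fin_three ((c / r) • e)
    have h2 : ‖(c / r) • e‖ ^ 2 = 6 := by
      rw [norm_smul, her, Real.norm_of_nonneg (by positivity), div_mul_cancel₀ _ hr0.ne', hc]
    generalize (c / r) • e = ν at h1 h2
    nlinarith [sq_nonneg (ν 0 + ν 1), sq_nonneg (ν 2)]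
  have hp : p ∈ closure Ω := by
    refine subset_closure (hzr (hxp p ?_))
    simp only [sub_self, norm_zero]
    positivity
  have hK : ∀ t, t ≠ p → inner ℝ ((c / r) • e) (t - p) ≤ c * r / 6 →
      ‖t - p‖ ≤ inner ℝ ((c / r) • e) (t - p) → t ∈ Ω := by
    exact fun t _ h1 h2 => hzr (hxp t (h2.trans h1))
  have hbase : ∀ t, inner ℝ ((c / r) • e) (t - p) = c * r / 6 → ‖t - p‖ ≤ c * r / 6 →
      t ∈ closure Ω → quadP t < u t := by
    intro t h1 h2 _
    refine (hyr ?_).2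
    rw [hin] at h1
    have h3 : inner ℝ e (t - p) = r ^ 2 / 6 := by
      field_simp at h1
      linarith
    have h4 : t - y = (t - p) - (21 / 20 : ℝ) • e := by
      rw [hpdef, he]; module
    have h5 : ‖t - p‖ ^ 2 ≤ r ^ 2 / 6 := by
      have := pow_le_pow_left₀ (norm_nonneg _) h2 2
      rw [div_pow, mul_pow, hc] at this
      linarith
    have h6 : ‖t - y‖ ^ 2 < r ^ 2 := by
      rw [h4, norm_sub_sq_real, real_inner_smul_right, real_inner_comm, h3, norm_smul, her]
      norm_num
      nlinarith [sq_pos_of_pos hr0]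
    rw [mem_ball_iff_norm]
    exact lt_of_pow_lt_pow_left₀ 2 hr0.le h6
  obtain ⟨ε, hε, hb⟩ := exists_cone_barrier hu huc hdet hle hν hp hK hbase
  have hz1 : z - p = (1 / 20 : ℝ) • e := by rw [hpdef, sub_sub_cancel]
  have hz2 : inner ℝ ((c / r) • e) (z - p) = c * r / 20 := by
    rw [hz1, real_inner_smul_left, real_inner_smul_right, real_inner_self_eq_norm_sq, her]
    field_simp
  have hz3 : ‖z - p‖ = r / 20 := by
    rw [hz1, norm_smul, her]; norm_num; ring
  have h1 : 1 ≤ c := by nlinarith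
  have hcr := mul_pos hc0 hr0
  have := hb z (by rw [hz2]; linarith) (by rw [hz2, hz3]; nlinarith)
  rw [hz2, hz3] at this
  refine hzU ⟨hzΩ, lt_of_lt_of_le ?_ this⟩
  have : 0 < (c * r / 20) ^ 2 - (r / 20) ^ 2 := by
    have : (c * r / 20) ^ 2 - (r / 20) ^ 2 = r ^ 2 / 80 := by
      rw [div_pow, mul_pow, hc]; ring
    rw [this]; positivity
  linarith [mul_pos hε this]

end ModelQuadratic

/-! ### One-sided calculus up to the boundary. -/

/-- Restricting to the segment from `x` to `y` reduces this to uniqueness of one-sided derivatives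
on [0,1], so `x` may be a corner. -/
theorem HasFDerivWithinAt.apply_sub_eq_zero {E F : Type*} [NormedAddCommGroup E] [NormedSpace ℝ E]
    [NormedAddCommGroup F] [NormedSpace ℝ F] {g : E → F} {g' : E →L[ℝ] F} {s t : Set E} {x y : E}
    (hg : HasFDerivWithinAt g g' s x) (hts : t ⊆ s) (ht : Convex ℝ t) (hx : x ∈ t) (hy : y ∈ t)
    (h0 : ∀ z ∈ t, g z = 0) : g' (y - x) = 0 := by
  have hmaps : MapsTo (AffineMap.lineMap x y : ℝ → E) (Icc 0 1) t := fun r hr =>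
    ht.segment_subset hx hy (segment_eq_image_lineMap ℝ x y ▸ mem_image_of_mem _ hr)
  have h1 : HasDerivWithinAt (g ∘ (AffineMap.lineMap x y : ℝ → E)) (g' (y - x)) (Icc 0 1) 0 := by
    refine HasFDerivWithinAt.comp_hasDerivWithinAt (t := s) (0 : ℝ) ?_
      AffineMap.hasDerivWithinAt_lineMap (hmaps.mono_right hts)
    simpa using hg
  have h2 : HasDerivWithinAt (g ∘ (AffineMap.lineMap x y : ℝ → E)) 0 (Icc 0 1) 0 :=
    (hasDerivWithinAt_const (0 : ℝ) (Icc 0 1) (0 : F)).congr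
      (fun r hr => h0 _ (hmaps hr)) (h0 _ (hmaps (by simp)))
  exact (uniqueDiffOn_Icc_zero_one 0 (by simp)).eq_deriv _ h1 h2

/-- A function whose first two one-sided derivatives at `0` vanish has no quadratic lower bound. -/
theorem not_quadratic_lower_bound {φ ψ : ℝ → ℝ} {c δ : ℝ} (hc : 0 < c) (hδ : 0 < δ)
    (hφ : ∀ t ∈ Icc (0 : ℝ) 1, HasDerivWithinAt φ (ψ t) (Icc 0 1) t)
    (hψ : HasDerivWithinAt ψ 0 (Icc 0 1) 0) (hψ0 : ψ 0 = 0) (hφ0 : φ 0 = 0)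
    (hlow : ∀ t ∈ Ioo (0 : ℝ) δ, c * t ^ 2 ≤ φ t) : False := by
  have h1 := (hasDerivWithinAt_iff_isLittleO.mp hψ).def (half_pos hc)
  obtain ⟨η, hη, h⟩ := Metric.mem_nhdsWithin_iff.mp h1
  have hbound : ∀ t ∈ Icc (0 : ℝ) 1, t < η → ‖ψ t‖ ≤ c / 2 * t := by
    intro t ht htη
    have := h ⟨by rwa [Metric.mem_ball, Real.dist_eq, sub_zero, abs_of_nonneg ht.1], ht⟩
    simpa [hψ0, abs_of_nonneg ht.1] using this
  obtain ⟨t, ht0, ht⟩ := exists_between (lt_min hη (lt_min hδ one_pos))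
  rw [lt_min_iff, lt_min_iff] at ht
  have hsub : Icc 0 t ⊆ Icc (0 : ℝ) 1 := Icc_subset_Icc_right ht.2.2.le
  -- The mean value inequality with |ψ| ≤ (c/2)t on [0,t] gives |φ(t)| ≤ (c/2)t².
  have := (convex_Icc 0 t).norm_image_sub_le_of_norm_hasDerivWithin_le (C := c / 2 * t)
    (fun r hr => (hφ r (hsub hr)).mono hsub)
    (fun r hr => (hbound r (hsub hr) (hr.2.trans_lt ht.1)).trans
      (mul_le_mul_of_nonneg_left hr.2 (by positivity)))
    (left_mem_Icc.mpr ht0.le) (right_mem_Icc.mpr ht0.le)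
  rw [hφ0, sub_zero, sub_zero, Real.norm_of_nonneg ht0.le] at this
  have h3 := hlow t ⟨ht0, ht.2.1⟩
  have h4 := (Real.le_norm_self _).trans this
  nlinarith [mul_pos hc (mul_pos ht0 ht0)]

/-! ### Geometry of the box and its faces. -/

section Box

/-- The lower corner of `boxDomain`. -/
def boxLo : Fin 3 → ℝ := ![0, 0, -2]

/-- The upper corner of `boxDomain`. -/
def boxHi : Fin 3 → ℝ := ![4, 4, 2]

theorem boxLo_lt_boxHi (i : Fin 3) : boxLo i < boxHi i := by
  fin_cases i <;> norm_num [boxLo, boxHi]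

theorem boxDomain_eq_preimage : boxDomain = EuclideanSpace.equiv (Fin 3) ℝ ⁻¹'
    univ.pi fun i => Ioo (boxLo i) (boxHi i) := by
  ext x
  simp only [boxDomain, mem_ofPred_eq, mem_preimage, mem_univ_pi, Fin.forall_fin_succ, boxLo, boxHi]
  simp

theorem isOpen_boxDomain : IsOpen boxDomain := by
  rw [boxDomain_eq_preimage]
  exact (isOpen_set_pi finite_univ fun _ _ => isOpen_Ioo).preimage
    (EuclideanSpace.equiv (Fin 3) ℝ).continuous

theorem convex_boxDomain : Convex ℝ boxDomain := by
  rw [boxDomain_eq_preimage]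
  exact (convex_pi fun _ _ => convex_Ioo _ _).linear_preimage
    (EuclideanSpace.equiv (Fin 3) ℝ).toLinearMap

theorem mem_closure_boxDomain {x : EuclideanSpace ℝ (Fin 3)} :
    x ∈ closure boxDomain ↔ ∀ i, x i ∈ Icc (boxLo i) (boxHi i) := by
  have h := (EuclideanSpace.equiv (Fin 3) ℝ).toHomeomorph.preimage_closure
    (univ.pi fun i => Ioo (boxLo i) (boxHi i))
  rw [boxDomain_eq_preimage]
  refine (Set.ext_iff.mp h x).symm.trans ?_
  change _ ∈ closure (univ.pi _) ↔ _
  rw [closure_pi_set]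
  simp only [closure_Ioo (boxLo_lt_boxHi _).ne, mem_univ_pi]
  rfl

theorem isBounded_boxDomain : Bornology.IsBounded boxDomain := by
  refine Metric.isBounded_closedBall (x := 0) (r := 6) |>.subset fun x hx => ?_
  obtain ⟨⟨h1, h2⟩, ⟨h3, h4⟩, h5, h6⟩ := hx
  rw [mem_closedBall_zero_iff]
  refine le_of_sq_le_sq ?_ (by norm_num)
  rw [norm_sq_fin_three]
  nlinarith

theorem nonempty_boxDomain : boxDomain.Nonempty :=
  ⟨!₂[1, 1, 0], by simp [boxDomain]⟩

theorem uniqueDiffOn_closure_boxDomain : UniqueDiffOn ℝ (closure boxDomain) :=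
  uniqueDiffOn_convex convex_boxDomain.closure
    (nonempty_boxDomain.mono (interior_maximal subset_closure isOpen_boxDomain))

/-- The points of the closed box with `i`-th coordinate `a`. -/
def boxFace (i : Fin 3) (a : ℝ) : Set (EuclideanSpace ℝ (Fin 3)) :=
  {x | x ∈ closure boxDomain ∧ x i = a}

theorem convex_boxFace (i : Fin 3) (a : ℝ) : Convex ℝ (boxFace i a) :=
  convex_boxDomain.closure.inter
    ((convex_singleton a).linear_preimage (EuclideanSpace.proj i).toLinearMap)

theorem boxFace_subset_frontier {i : Fin 3} {a : ℝ} (ha : a = boxLo i ∨ a = boxHi i) :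
    boxFace i a ⊆ frontier boxDomain := by
  rintro x ⟨hx, hxi⟩
  rw [isOpen_boxDomain.frontier_eq]
  refine ⟨hx, fun h => ?_⟩
  rw [boxDomain_eq_preimage] at h
  have h' : x i ∈ Ioo (boxLo i) (boxHi i) := h i (mem_univ i)
  rw [hxi] at h'
  rcases ha with rfl | rfl
  · exact h'.1.ne rfl
  · exact h'.2.ne rfl

/-- A function vanishing on a face of the box has vanishing tangential derivatives there. -/
theorem HasFDerivWithinAt.apply_single_eq_zero {F : Type*} [NormedAddCommGroup F] [NormedSpace ℝ F]
    {g : EuclideanSpace ℝ (Fin 3) → F} {g' : EuclideanSpace ℝ (Fin 3) →L[ℝ] F}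
    {x : EuclideanSpace ℝ (Fin 3)} (hg : HasFDerivWithinAt g g' (closure boxDomain) x)
    {i : Fin 3} {a : ℝ} (hx : x ∈ boxFace i a) (h0 : ∀ z ∈ boxFace i a, g z = 0) {j : Fin 3}
    (hj : j ≠ i) : g' (EuclideanSpace.single j 1) = 0 := by
  -- Some endpoint of the `j`-th side differs from `x j`, so the face contains a segment from `x`
  -- parallel to the `j`-th axis, even at edges and corners.
  obtain ⟨b, hb, hbx⟩ : ∃ b ∈ Icc (boxLo j) (boxHi j), b - x j ≠ 0 := by
    by_cases h : boxLo j = x j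
    · exact ⟨boxHi j, right_mem_Icc.mpr (boxLo_lt_boxHi j).le,
        sub_ne_zero.mpr (h ▸ (boxLo_lt_boxHi j).ne')⟩
    · exact ⟨boxLo j, left_mem_Icc.mpr (boxLo_lt_boxHi j).le, sub_ne_zero.mpr h⟩
  have hy : x + EuclideanSpace.single j (b - x j) ∈ boxFace i a := by
    refine ⟨mem_closure_boxDomain.mpr fun k => ?_, ?_⟩
    · by_cases hk : k = j
      · subst hk; simpa using hb
      · simpa [hk] using mem_closure_boxDomain.mp hx.1 k
    · simpa [hj.symm] using hx.2
  have h1 := hg.apply_sub_eq_zero (fun z hz => hz.1) (convex_boxFace i a) hx hy h0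
  have h2 : (EuclideanSpace.single j (b - x j) : EuclideanSpace ℝ (Fin 3))
      = (b - x j) • EuclideanSpace.single j 1 := by
    ext k; simp
  rw [add_sub_cancel_left, h2, map_smul] at h1
  exact (smul_eq_zero.mp h1).resolve_left hbx

/-- The convexity gap is ab·P(x - y), and 4P(v) = (v₁ - v₂)² + v₁² + v₂² + 2v₃². -/
theorem convexOn_quadP : ConvexOn ℝ univ quadP := by
  refine ⟨convex_univ, fun x _ y _ a b ha hb hab => ?_⟩
  obtain rfl : b = 1 - a := by linarith
  simp only [quadP, PiLp.add_apply, PiLp.smul_apply, smul_eq_mul]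
  nlinarith [mul_nonneg (mul_nonneg ha hb) (add_nonneg (add_nonneg
    (sq_nonneg ((x 0 - y 0) - (x 1 - y 1))) (sq_nonneg (x 2 - y 2)))
    (add_nonneg (add_nonneg (sq_nonneg (x 0 - y 0)) (sq_nonneg (x 1 - y 1)))
      (sq_nonneg (x 2 - y 2))))]

theorem isConvexC2Solution_quadP :
    IsConvexC2Solution boxDomain (fun _ => 3 / 4) quadP quadP where
  contDiffOn := contDiff_quadP.contDiffOn
  convexOn := convexOn_quadP.subset (subset_univ _) convex_boxDomain.closure
  det_eq x _ := by rw [hessianMatrix_quadP, det_hessP]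
  boundary_eq _ _ := rfl

variable {f u : EuclideanSpace ℝ (Fin 3) → ℝ}

theorem IsConvexC2Solution.contDiffAt {n : ℕ} {Ω : Set (EuclideanSpace ℝ (Fin n))}
    {f φ u : EuclideanSpace ℝ (Fin n) → ℝ} (hu : IsConvexC2Solution Ω f φ u) (hΩ : IsOpen Ω)
    {x : EuclideanSpace ℝ (Fin n)} (hx : x ∈ Ω) : ContDiffAt ℝ 2 u x :=
  hu.contDiffOn.contDiffAt (mem_of_superset (hΩ.mem_nhds hx) subset_closure)

/-! ### Quadratic growth against second-order contact at the edge. -/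

/-- Solutions with a smaller right-hand side separate quadratically from `quadP` along the diagonal
issuing from the obtuse edge. -/
theorem exists_quadratic_separation (hu : IsConvexC2Solution boxDomain f quadP u)
    (hf : ∀ x ∈ boxDomain, f x ≤ 3 / 4) (hne : ∃ x ∈ boxDomain, f x ≠ 3 / 4) :
    ∃ c > 0, ∀ t ∈ Ioo (0 : ℝ) (1 / 2), c * t ^ 2 ≤
      u (t • !₂[1, 1, 0]) - quadP (t • !₂[1, 1, 0]) := by
  have hu2 : ∀ x ∈ boxDomain, ContDiffAt ℝ 2 u x := fun x hx => hu.contDiffAt isOpen_boxDomain hx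
  have huc := hu.contDiffOn.continuousOn
  have hdet : ∀ x ∈ boxDomain, (hessianMatrix u x).det ≤ 3 / 4 := fun x hx =>
    (hu.det_eq x hx).trans_le (hf x hx)
  have hle := quadP_le_of_det_le isOpen_boxDomain isBounded_boxDomain hu2 huc hdet
    fun x hx => (hu.boundary_eq x hx).ge
  have hlt : ∀ x ∈ boxDomain, quadP x < u x := by
    refine quadP_lt_of_det_le isOpen_boxDomain convex_boxDomain.isPreconnected hu2 huc hdet hle ?_
    by_contra! h
    obtain ⟨x, hx, hfx⟩ := hne
    have he : u =ᶠ[𝓝 x] quadP := by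
      filter_upwards [isOpen_boxDomain.mem_nhds hx] with y hy
        using le_antisymm (h y hy) (hle y (subset_closure hy))
    have hH : hessianMatrix u x = hessianMatrix quadP x := by
      unfold hessianMatrix
      rw [he.fderiv.fderiv_eq]
    rw [← hu.det_eq x hx, hH, hessianMatrix_quadP, det_hessP] at hfx
    exact hfx rfl
  -- For ν = a(1,1,0) the barrier needs 3a² > 11/4, while a < 1 keeps the cone, apex aside, strictly
  -- inside the quadrant x₁, x₂ > 0; a = 24/25 meets both.
  have hcone : ∀ x : EuclideanSpace ℝ (Fin 3), x ≠ 0 →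
      inner ℝ !₂[24 / 25, 24 / 25, 0] (x - 0) ≤ (1 : ℝ) →
      ‖x - 0‖ ≤ inner ℝ !₂[24 / 25, 24 / 25, 0] (x - 0) → x ∈ boxDomain := by
    intro x hx h1 h2
    have hpos : 0 < ‖x‖ := norm_pos_iff.mpr hx
    have hsq := norm_sq_fin_three x
    rw [sub_zero] at h1 h2
    have hin : inner ℝ !₂[24 / 25, 24 / 25, 0] x = 24 / 25 * (x 0 + x 1) := by
      simp [inner_fin_three]; ring
    rw [hin] at h1 h2
    have h3 : x 0 ^ 2 + x 1 ^ 2 + x 2 ^ 2 ≤ (24 / 25 * (x 0 + x 1)) ^ 2 := by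
      rw [← hsq]; exact pow_le_pow_left₀ hpos.le h2 2
    have hprod : 0 < x 0 * x 1 := by
      have : 0 < x 0 ^ 2 + x 1 ^ 2 + x 2 ^ 2 := hsq ▸ pow_pos hpos 2
      by_contra! hle
      nlinarith [sq_nonneg (x 2), sq_nonneg (x 0), sq_nonneg (x 1)]
    have hx0 : 0 < x 0 := by
      by_contra! h
      nlinarith
    have hx1 : 0 < x 1 := pos_of_mul_pos_right hprod hx0.le
    refine ⟨⟨hx0, by linarith⟩, ⟨hx1, by linarith⟩, ?_⟩
    have : x 2 ^ 2 ≤ 1 := by nlinarith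
    constructor <;> nlinarith
  obtain ⟨ε, hε, hb⟩ := exists_cone_barrier (ν := !₂[24 / 25, 24 / 25, 0]) (p := 0) (s := 1) hu2 huc
    hdet hle (by simp; norm_num) (mem_closure_boxDomain.mpr fun i => by
      fin_cases i <;> norm_num [boxLo, boxHi]) hcone (fun x h1 h2 _ => hlt x (hcone x
        (by rintro rfl; simp at h1) h1.le (h2.trans_eq h1.symm)))
  refine ⟨ε, hε, fun t ht => ?_⟩
  have hin : inner ℝ !₂[24 / 25, 24 / 25, 0] (t • (!₂[1, 1, 0] : EuclideanSpace ℝ (Fin 3)) - 0)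
      = 48 / 25 * t := by
    simp [inner_fin_three]; ring
  have hno : ‖t • (!₂[1, 1, 0] : EuclideanSpace ℝ (Fin 3)) - 0‖ ^ 2 = 2 * t ^ 2 := by
    rw [norm_sq_fin_three]; simp; ring
  -- On the diagonal the cone form is ((48/25)² - 2)t² ≥ t².
  have := hb (t • !₂[1, 1, 0]) (by rw [hin]; linarith [ht.2])
    (le_of_sq_le_sq (by rw [hin, hno]; nlinarith [sq_nonneg t]) (by rw [hin]; linarith [ht.1]))
  rw [hin, hno] at this
  nlinarith [mul_nonneg hε.le (sq_nonneg t)]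

/-- Second-order contact with `quadP` at the origin, along the diagonal. -/
theorem exists_fderiv_diagonal_eq_zero (hu : IsConvexC2Solution boxDomain f quadP u)
    (hfc : ContinuousOn f (closure boxDomain)) (hf : ∀ x ∈ frontier boxDomain, f x = 3 / 4) :
    ∃ (D : EuclideanSpace ℝ (Fin 3) → EuclideanSpace ℝ (Fin 3) →L[ℝ] ℝ)
      (D₂ : EuclideanSpace ℝ (Fin 3) →L[ℝ] EuclideanSpace ℝ (Fin 3) →L[ℝ] ℝ),
      (∀ x ∈ closure boxDomain, HasFDerivWithinAt (u - quadP) (D x) (closure boxDomain) x) ∧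
      HasFDerivWithinAt D D₂ (closure boxDomain) 0 ∧
      D 0 !₂[1, 1, 0] = 0 ∧ D₂ !₂[1, 1, 0] !₂[1, 1, 0] = 0 := by
  set K := closure boxDomain
  have hKu : UniqueDiffOn ℝ K := uniqueDiffOn_closure_boxDomain
  set w := u - quadP
  have hw : ContDiffOn ℝ 2 w K := hu.contDiffOn.sub contDiff_quadP.contDiffOn
  set D := fderivWithin ℝ w K
  have hD : ContDiffOn ℝ 1 D K := hw.fderivWithin hKu (by norm_num)
  set D₂ := fderivWithin ℝ D K
  have hD₂ : ContinuousOn D₂ K := (hD.fderivWithin (m := 0) hKu (by norm_num)).continuousOn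
  have hwD : ∀ x ∈ K, HasFDerivWithinAt w (D x) K x := fun x hx =>
    (hw.differentiableOn (by norm_num) x hx).hasFDerivWithinAt
  have hDD : ∀ x ∈ K, HasFDerivWithinAt D (D₂ x) K x := fun x hx =>
    (hD.differentiableOn (by norm_num) x hx).hasFDerivWithinAt
  let e : Fin 3 → EuclideanSpace ℝ (Fin 3) := fun i => EuclideanSpace.single i 1
  let H : EuclideanSpace ℝ (Fin 3) → Matrix (Fin 3) (Fin 3) ℝ := fun x =>
    Matrix.of fun i j => D₂ x (e i) (e j)
  have hsymm : ∀ x ∈ K, ∀ i j, H x i j = H x j i := fun x hx i j => by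
    refine ((hw x hx).isSymmSndFDerivWithinAt (by simp) hKu ?_ hx).eq (e i) (e j)
    exact closure_mono (interior_maximal subset_closure isOpen_boxDomain) hx
  have hHc : ContinuousOn H K := by
    refine continuousOn_pi.mpr fun i => continuousOn_pi.mpr fun j => ?_
    exact (hD₂.clm_apply continuousOn_const).clm_apply continuousOn_const
  -- The equation passes to the closed box by continuity of the second derivatives and of `f`.
  have hdet : EqOn (fun x => (hessP + H x).det) f K := by
    refine EqOn.of_subset_closure (s := boxDomain) (fun x hx => ?_) ?_ hfc subset_closure
      subset_rfl
    · have hKx : K ∈ 𝓝 x := mem_of_superset (isOpen_boxDomain.mem_nhds hx) subset_closure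
      have h1 : D =ᶠ[𝓝 x] fderiv ℝ w := by
        filter_upwards [isOpen_boxDomain.mem_nhds hx] with y hy
        exact fderivWithin_of_mem_nhds
          (mem_of_superset (isOpen_boxDomain.mem_nhds hy) subset_closure)
      have h2 : H x = hessianMatrix w x := by
        ext i j
        simp only [H, D₂, hessianMatrix, Matrix.of_apply]
        rw [fderivWithin_of_mem_nhds hKx, h1.fderiv_eq]
      change (hessP + H x).det = f x
      rw [h2, hessianMatrix_sub (hu.contDiffAt isOpen_boxDomain hx) contDiff_quadP.contDiffAt,
        hessianMatrix_quadP, add_sub_cancel, hu.det_eq x hx]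
    · exact (continuous_id.matrix_det.comp_continuousOn (continuousOn_const.add hHc))
  have hface0 : ∀ i a, (a = boxLo i ∨ a = boxHi i) → ∀ x ∈ boxFace i a, w x = 0 :=
    fun i a ha x hx => sub_eq_zero.mpr (hu.boundary_eq x (boxFace_subset_frontier ha hx))
  have hface1 : ∀ i a, (a = boxLo i ∨ a = boxHi i) → ∀ j ≠ i, ∀ x ∈ boxFace i a, D x (e j) = 0 :=
    fun i a ha j hj x hx => (hwD x hx.1).apply_single_eq_zero hx (hface0 i a ha) hj
  have hface2 : ∀ i a, (a = boxLo i ∨ a = boxHi i) → ∀ j ≠ i, ∀ k ≠ i, ∀ x ∈ boxFace i a,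
      H x k j = 0 := fun i a ha j hj k hk x hx => by
    have h1 : HasFDerivWithinAt (fun x => D x (e j))
        ((ContinuousLinearMap.apply ℝ ℝ (e j)).comp (D₂ x)) K x :=
      (ContinuousLinearMap.apply ℝ ℝ (e j)).hasFDerivAt.comp_hasFDerivWithinAt x (hDD x hx.1)
    exact h1.apply_single_eq_zero hx (hface1 i a ha j hj) hk
  let γ : ℝ → EuclideanSpace ℝ (Fin 3) := fun t => !₂[0, 0, t]
  have hγc : Continuous γ := by fun_prop
  have hγK : ∀ t ∈ Icc (0 : ℝ) 2, γ t ∈ K := fun t ht => mem_closure_boxDomain.mpr fun i => by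
    fin_cases i <;> simp [γ, boxLo, boxHi]
    exact ⟨by linarith [ht.1], ht.2⟩
  have hγ0 : ∀ t ∈ Icc (0 : ℝ) 2, γ t ∈ boxFace 0 0 := fun t ht => ⟨hγK t ht, by simp [γ]⟩
  have hγ1 : ∀ t ∈ Icc (0 : ℝ) 2, γ t ∈ boxFace 1 0 := fun t ht => ⟨hγK t ht, by simp [γ]⟩
  have a0 : (0 : ℝ) = boxLo 0 ∨ (0 : ℝ) = boxHi 0 := Or.inl rfl
  have a1 : (0 : ℝ) = boxLo 1 ∨ (0 : ℝ) = boxHi 1 := Or.inl rfl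
  -- On the edge only the (0,1) entry h of `H` and its mirror survive, so the equation reads 1 - (h
  -- - 1/2)² = 3/4.
  have hroot : ∀ t ∈ Icc (0 : ℝ) 2, H (γ t) 0 1 * (H (γ t) 0 1 - 1) = 0 := fun t ht => by
    have h := hdet (hγK t ht)
    rw [hf _ (boxFace_subset_frontier a0 (hγ0 t ht))] at h
    have f0 := fun j hj k hk => hface2 0 0 a0 j hj k hk _ (hγ0 t ht)
    have f1 := fun j hj k hk => hface2 1 0 a1 j hj k hk _ (hγ1 t ht)
    simp only [det_fin_three, Matrix.add_apply, f0 1 (by decide) 1 (by decide),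
      f0 1 (by decide) 2 (by decide), f0 2 (by decide) 1 (by decide),
          f0 2 (by decide) 2 (by decide),
      f1 0 (by decide) 0 (by decide), f1 0 (by decide) 2 (by decide),
          f1 2 (by decide) 0 (by decide),
      hsymm _ (hγK t ht) 1 0] at h
    simp [hessP] at h
    linarith
  have hcorner : H (γ 2) 0 1 = 0 :=
    hface2 2 2 (Or.inr rfl) 1 (by decide) 0 (by decide) _ ⟨hγK 2 (by simp), by simp [γ]⟩
  -- Otherwise h would pass from 1 at the origin to 0 at the vertex, taking the value 1/2, which is
  -- not a root.
  have h01 : H (γ 0) 0 1 = 0 := by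
    by_contra hne
    have h1 : H (γ 0) 0 1 = 1 :=
      sub_eq_zero.mp ((mul_eq_zero.mp (hroot 0 (by simp))).resolve_left hne)
    have hc : ContinuousOn (fun t => H (γ t) 0 1) (Icc 0 2) :=
      continuousOn_pi.mp (continuousOn_pi.mp (hHc.comp hγc.continuousOn hγK) 0) 1
    obtain ⟨t, ht, h2⟩ := intermediate_value_Icc' (by norm_num) hc
      (show (1 / 2 : ℝ) ∈ Icc _ _ from ⟨by simp only [hcorner]; norm_num, by
        simp only [h1]; norm_num⟩)
    have := hroot t ht
    simp only at h2
    rw [h2] at this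
    norm_num at this
  have hz : γ 0 = 0 := by ext i; fin_cases i <;> simp [γ]
  have z0 : (0 : EuclideanSpace ℝ (Fin 3)) ∈ boxFace 0 0 := hz ▸ hγ0 0 (by simp)
  have z1 : (0 : EuclideanSpace ℝ (Fin 3)) ∈ boxFace 1 0 := hz ▸ hγ1 0 (by simp)
  rw [hz] at h01
  set ξ : EuclideanSpace ℝ (Fin 3) := !₂[1, 1, 0]
  have hξ : ξ = e 0 + e 1 := by
    ext i; fin_cases i <;> simp [ξ, e]
  have hD₂ξ : D₂ 0 ξ ξ = 0 := by
    have h10 := hsymm 0 z0.1 1 0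
    have h11 := hface2 0 0 a0 1 (by decide) 1 (by decide) 0 z0
    have h00 := hface2 1 0 a1 0 (by decide) 0 (by decide) 0 z1
    simp only [H, Matrix.of_apply] at h01 h10 h11 h00
    rw [hξ]
    simp only [map_add, _root_.add_apply]
    rw [h10, h11, h00, h01]
    norm_num
  refine ⟨D, D₂ 0, hwD, hDD 0 z0.1, ?_, hD₂ξ⟩
  rw [hξ, map_add, hface1 1 0 a1 0 (by decide) 0 z1, hface1 0 0 a0 1 (by decide) 0 z0, add_zero]

/-- The chain rule along the diagonal puts the contact in the one-variable form that
`not_quadratic_lower_bound` refutes. -/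
theorem second_order_contact (hu : IsConvexC2Solution boxDomain f quadP u)
    (hfc : ContinuousOn f (closure boxDomain)) (hf : ∀ x ∈ frontier boxDomain, f x = 3 / 4) :
    ∃ ψ : ℝ → ℝ, (∀ t ∈ Icc (0 : ℝ) 1, HasDerivWithinAt
        (fun t : ℝ => u (t • !₂[1, 1, 0]) - quadP (t • !₂[1, 1, 0])) (ψ t) (Icc 0 1) t) ∧
      HasDerivWithinAt ψ 0 (Icc 0 1) 0 ∧ ψ 0 = 0 := by
  obtain ⟨D, D₂, hwD, hDD, hD0, hD₂0⟩ := exists_fderiv_diagonal_eq_zero hu hfc hf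
  have hray : MapsTo (fun t : ℝ => t • (!₂[1, 1, 0] : EuclideanSpace ℝ (Fin 3))) (Icc 0 1)
      (closure boxDomain) := fun t ht => mem_closure_boxDomain.mpr fun i => by
    fin_cases i <;> simp [boxLo, boxHi] <;> constructor <;> linarith [ht.1, ht.2]
  generalize (!₂[1, 1, 0] : EuclideanSpace ℝ (Fin 3)) = ξ at *
  have hray' : ∀ t : ℝ, HasDerivWithinAt (fun t : ℝ => t • ξ) ξ (Icc 0 1) t := fun t => by
    have := ((hasDerivAt_id t).smul_const ξ).hasDerivWithinAt (s := Icc 0 1)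
    rwa [one_smul] at this
  refine ⟨fun t => D (t • ξ) ξ, fun t ht => ?_, ?_, by simpa using hD0⟩
  · exact (hwD _ (hray ht)).comp_hasDerivWithinAt t (hray' t) hray
  · have h1 : HasFDerivWithinAt D D₂ (closure boxDomain) ((0 : ℝ) • ξ) := by rwa [zero_smul]
    have h2 : HasDerivWithinAt (fun t : ℝ => D (t • ξ)) (D₂ ξ) (Icc 0 1) 0 :=
      HasFDerivWithinAt.comp_hasDerivWithinAt (t := closure boxDomain) 0 h1 (hray' 0) hray
    have h3 := h2.clm_apply (hasDerivWithinAt_const (0 : ℝ) (Icc 0 1) ξ)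
    rwa [hD₂0, map_zero, zero_add] at h3

end Box

theorem mainTheorem7 :
    (ContDiffOn ℝ ∞ quadP (closure boxDomain) ∧
      IsConvexC2Solution boxDomain (fun _ => 3 / 4) quadP quadP) ∧
    ∀ f : EuclideanSpace ℝ (Fin 3) → ℝ,
      ContDiffOn ℝ ∞ f (closure boxDomain) →
      (∀ x ∈ frontier boxDomain, f x = 3 / 4) →
      (∀ x ∈ boxDomain, 0 < f x ∧ f x ≤ 3 / 4) →
      (∃ x ∈ boxDomain, f x ≠ 3 / 4) →
      (∀ x ∈ frontier boxDomain, (hessianMatrix quadP x).det = f x) ∧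
      ¬ ∃ u : EuclideanSpace ℝ (Fin 3) → ℝ, IsConvexC2Solution boxDomain f quadP u := by
  refine ⟨⟨contDiff_quadP.contDiffOn, isConvexC2Solution_quadP⟩, fun f hfc hfb hf hne =>
    ⟨fun x hx => by rw [hessianMatrix_quadP, det_hessP, hfb x hx], ?_⟩⟩
  rintro ⟨u, hu⟩
  obtain ⟨c, hc, hlow⟩ := exists_quadratic_separation hu (fun x hx => (hf x hx).2) hne
  obtain ⟨ψ, hφ, hψ, hψ0⟩ := second_order_contact hu hfc.continuousOn hfb
  refine not_quadratic_lower_bound hc (by norm_num) hφ hψ hψ0 ?_ hlow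
  have h0 : (0 : EuclideanSpace ℝ (Fin 3)) ∈ boxFace 0 0 :=
    ⟨mem_closure_boxDomain.mpr fun i => by fin_cases i <;> norm_num [boxLo, boxHi], rfl⟩
  simpa using sub_eq_zero.mpr (hu.boundary_eq 0 (boxFace_subset_frontier (Or.inl rfl) h0))
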